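/- **Setting.** Let $p$ be a prime and let $(S,\mathcal F,\mathcal L)$ be a $p$-local finite group: $S$ is a finite $p$-group, $\mathcal F$ is a saturated fusion system over $S$, and $\mathcal L$ is a centric linking system associated to $\mathcal F$, with structure functors $\delta:\mathcal T^c_S(S)\to\mathcal L$ and $\pi:\mathcal L\to\mathcal F$. Let $\pi_{\mathcal L}=\pi_1(|\mathcal L|,S)$. For $\mathcal F$-centric $P$ put $\iota_P=\delta_{P,S}(1)$, and for a morphism $f:P\to Q$ of $\mathcal L$ let $\omega(f)\in\pi_{\mathcal L}$ be the class of the loop $\iota_Q\cdot f\cdot\overline{\iota_P}$ (read from right to left). Every $\mathbb Z_{(p)}[\pi_{\mathcal L}]$-module is regarded as a $\mathbb Z_{(p)}[S]$-module through $g\mapsto\omega(\delta_{S,S}(g))$. Let $\Omega$ be an $\mathcal F$-characteristic $(S,S)$-biset, that is, a finite left-free $(S,S)$-biset such that: every transitive component of $\Omega$ is isomorphic to some $[P,\varphi]=(S\times S)/\{(u,\varphi(u)) : u\in P\}$ with $P\le S$ and $\varphi\in\mathrm{Hom}_{\mathcal F}(P,S)$; for all such $(P,\varphi)$ one has ${}_\varphi\Omega_S\cong{}_P\Omega_S$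 and ${}_S\Omega_\varphi\cong{}_S\Omega_P$; and $p\nmid|\Omega|/|S|$. An $\Omega$-endomorphism $\omega_*$ is given by the following choices. For each transitive component of $\Omega$, choose a pair $(P,\varphi)$ such that the component is isomorphic to $[P,\varphi]$, subgroups $P=P_0,P_1,\dots,P_r=\varphi(P)$ of $S$, $\mathcal F$-centric subgroups $Q_i\ge P_{i-1},P_i$ and $\psi_i\in\mathrm{Aut}_{\mathcal L}(Q_i)$ with $\pi(\psi_i)(P_{i-1})=P_i$, such that $\varphi=\mathrm{incl}\circ\pi(\psi_r)|_{P_{r-1}}^{P_r}\circ\dots\circ\pi(\psi_1)|_{P_0}^{P_1}$. Then, for every $\mathbb Z_{(p)}[\pi_{\mathcal L}]$-module $M$ and every $k\ge 0$, $\omega_k\in\mathrm{End}(H^k(S,M))$ is the sum over the transitive components of $\Omega$ of $$\mathrm{tr}_P^S\circ H^k\big(\pi(\psi_1)|_{P_0}^{P_1},\omega(\psi_1)^{-1}\big)\circ\dots\circ H^k\big(\pi(\psi_r)|_{P_{r-1}}^{P_r},\omega(\psi_r)^{-1}\big)\circ\mathrm{Res}^S_{\varphi(P)} .$$ **Proposition.**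 Let $\omega_*$ be an $\Omega$-endomorphism. Here $M$ ranges over the abelian $p$-groups with an action of $\pi_{\mathcal L}$ (finite, as all $p$-groups here), that is, over the finite $\mathbb Z_{(p)}[\pi_{\mathcal L}]$-modules. There are integers $N_{k,M}>0$ such that $\big(\tfrac{|S|}{|\Omega|}\omega_k\big)^{N_{k,M}}$ is an idempotent of $H^k(S,M)$ for all $k\ge0$ and all $M$. For any such choice of integers, let $$\overline\omega_{k,M}=\Big(\tfrac{|S|}{|\Omega|}\,\omega_k\Big)^{\prod_{i=0}^kN_{i,M}}\in\mathrm{End}(H^k(S,M))$$ be the $\mathcal F^c$-characteristic idempotent associated to $\omega_*$. Then every $\overline\omega_{k,M}$ is an idempotent, and $\overline\omega_{*,-}$ is an endomorphism of the $\delta$-functor $(H^*(S,-),\delta_{H^*(S,-)})$ on the category of finite $\mathbb Z_{(p)}[\pi_{\mathcal L}]$-modules, that is: 1. for every homomorphism $f:M\to N$ of finite $\mathbb Z_{(p)}[\pi_{\mathcal L}]$-modules and every $k\ge0$, $\;f_*\circ\overline\omega_{k,M}=\overline\omega_{k,N}\circ f_*$ as maps $H^k(S,M)\to H^k(S,N)$;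 2. for every short exact sequence $0\to L\to M\to N\to 0$ of finite $\mathbb Z_{(p)}[\pi_{\mathcal L}]$-modules and every $k\ge0$, $\;\delta\circ\overline\omega_{k,N}=\overline\omega_{k+1,L}\circ\delta$ as maps $H^k(S,N)\to H^{k+1}(S,L)$. -/

import Mathlib

open CategoryTheory

namespace NerveRealization

open Simplicial Opposite

variable {C : Type} [Category.{0} C]

/-- The characteristic map `Δⁿ → |N C|` of an `n`-simplex of the nerve of `C`. -/
noncomputable def simplexMap {n : ℕ} (a : ComposableArrows C n) :
    C(stdSimplex ℝ (Fin (n + 1)), SSet.toTop.obj (nerve C)) :=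
  TopCat.toSSetObjEquiv _ (op ⦋n⦌) ((sSetTopAdj.unit.app (nerve C)).app (op ⦋n⦌) a)

lemma simplexMap_δ {n : ℕ} (a : ComposableArrows C (n + 1)) (i : Fin (n + 2))
    (z : stdSimplex ℝ (Fin (n + 1))) :
    simplexMap ((nerve C).δ i a) z = simplexMap a (stdSimplex.map i.succAbove z) := by
  have h := ConcreteCategory.congr_hom
    ((sSetTopAdj.unit.app (nerve C)).naturality (SimplexCategory.δ i).op) a
  exact congrArg (fun b => TopCat.toSSetObjEquiv _ (op ⦋n⦌) b z) h

/-- The vertex of `|N C|` given by an object of `C`. -/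
noncomputable def point (x : C) : SSet.toTop.obj (nerve C) :=
  simplexMap (ComposableArrows.mk₀ x) (stdSimplex.vertex 0)

lemma simplexMap_vertex_zero {x y : C} (f : x ⟶ y) :
    simplexMap (ComposableArrows.mk₁ f) (stdSimplex.vertex 0) = point x := by
  have h : (nerve C).δ 1 (ComposableArrows.mk₁ f) = ComposableArrows.mk₀ x :=
    ComposableArrows.ext₀ rfl
  rw [point, ← h, simplexMap_δ, stdSimplex.map_vertex]
  rfl

lemma simplexMap_vertex_one {x y : C} (f : x ⟶ y) :
    simplexMap (ComposableArrows.mk₁ f) (stdSimplex.vertex 1) = point y := by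
  have h : (nerve C).δ 0 (ComposableArrows.mk₁ f) = ComposableArrows.mk₀ y :=
    ComposableArrows.ext₀ rfl
  rw [point, ← h, simplexMap_δ, stdSimplex.map_vertex]
  rfl

/-- The edge of `|N C|` given by a morphism of `C`, as a path. -/
noncomputable def edgePath {x y : C} (f : x ⟶ y) : Path (point x) (point y) where
  toFun t := simplexMap (ComposableArrows.mk₁ f) (stdSimplexHomeomorphUnitInterval.symm t)
  continuous_toFun := by fun_prop
  source' := by
    rw [← simplexMap_vertex_zero f, ← stdSimplexHomeomorphUnitInterval_zero,
      Homeomorph.symm_apply_apply]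
  target' := by
    rw [← simplexMap_vertex_one f, ← stdSimplexHomeomorphUnitInterval_one,
      Homeomorph.symm_apply_apply]

/-- The homotopy class (rel endpoints) of the edge of `|N C|` given by a morphism of `C`. -/
noncomputable def edge {x y : C} (f : x ⟶ y) :
    FundamentalGroupoid.mk (point x) ⟶ FundamentalGroupoid.mk (point y) :=
  FundamentalGroupoid.fromPath (Path.Homotopic.Quotient.mk (edgePath f))

lemma simplyConnectedSpace_triangle :
    SimplyConnectedSpace (stdSimplex ℝ (Fin (2 + 1))) := by
  have : ContractibleSpace (stdSimplex ℝ (Fin (2 + 1))) :=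
    (convex_stdSimplex ℝ (Fin (2 + 1))).contractibleSpace ⟨_, single_mem_stdSimplex ℝ 0⟩
  infer_instance

/-- The affine path along an edge of the standard triangle. -/
noncomputable def trianglePath (i : Fin 3) :
    Path (stdSimplex.map i.succAbove (stdSimplex.vertex (S := ℝ) (0 : Fin 2)))
      (stdSimplex.map i.succAbove (stdSimplex.vertex (S := ℝ) (1 : Fin 2))) where
  toFun t := stdSimplex.map i.succAbove (stdSimplexHomeomorphUnitInterval.symm t)
  continuous_toFun := (stdSimplex.continuous_map _).comp (by fun_prop)
  source' := by
    congr 1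
    rw [← stdSimplexHomeomorphUnitInterval_zero, Homeomorph.symm_apply_apply]
  target' := by
    congr 1
    rw [← stdSimplexHomeomorphUnitInterval_one, Homeomorph.symm_apply_apply]

lemma edge_comp {x y z : C} (f : x ⟶ y) (g : y ⟶ z) :
    edge (f ≫ g) = edge f ≫ edge g := by
  set T := simplexMap (ComposableArrows.mk₂ f g) with hT
  have e2 : ∀ t, simplexMap (ComposableArrows.mk₁ f) t =
      T (stdSimplex.map (Fin.succAbove 2) t) := fun t => by
    rw [← nerve.δ₂_mk₂_eq f g]; exact simplexMap_δ _ _ _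
  have e0 : ∀ t, simplexMap (ComposableArrows.mk₁ g) t =
      T (stdSimplex.map (Fin.succAbove 0) t) := fun t => by
    rw [← nerve.δ₀_mk₂_eq f g]; exact simplexMap_δ _ _ _
  have e1 : ∀ t, simplexMap (ComposableArrows.mk₁ (f ≫ g)) t =
      T (stdSimplex.map (Fin.succAbove 1) t) := fun t => by
    rw [← nerve.δ₁_mk₂_eq f g]; exact simplexMap_δ _ _ _
  let v : Fin 3 → stdSimplex ℝ (Fin 3) := fun i => stdSimplex.vertex i
  let p2 : Path (v 0) (v 1) := (trianglePath 2).cast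
    (by rw [stdSimplex.map_vertex]; rfl) (by rw [stdSimplex.map_vertex]; rfl)
  let p0 : Path (v 1) (v 2) := (trianglePath 0).cast
    (by rw [stdSimplex.map_vertex]; rfl) (by rw [stdSimplex.map_vertex]; rfl)
  let p1 : Path (v 0) (v 2) := (trianglePath 1).cast
    (by rw [stdSimplex.map_vertex]; rfl) (by rw [stdSimplex.map_vertex]; rfl)
  have hx : T (v 0) = point x := by
    rw [← simplexMap_vertex_zero f, e2, stdSimplex.map_vertex]; rfl
  have hy : T (v 1) = point y := by
    rw [← simplexMap_vertex_one f, e2, stdSimplex.map_vertex]; rfl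
  have hz : T (v 2) = point z := by
    rw [← simplexMap_vertex_one g, e0, stdSimplex.map_vertex]; rfl
  have h : Path.Homotopic (p1.map T.continuous) ((p2.trans p0).map T.continuous) :=
    have := simplyConnectedSpace_triangle
    (SimplyConnectedSpace.paths_homotopic _ _).map T
  rw [Path.map_trans] at h
  have h1 : edgePath (f ≫ g) = (p1.map T.continuous).cast hx.symm hz.symm := by
    ext t; exact e1 _
  have h2 : edgePath f = (p2.map T.continuous).cast hx.symm hy.symm := by
    ext t; exact e2 _
  have h0 : edgePath g = (p0.map T.continuous).cast hy.symm hz.symm := by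
    ext t; exact e0 _
  have h3 := h.pathCast hx.symm hz.symm
  change Path.Homotopic.Quotient.mk _ = Path.Homotopic.Quotient.trans
    (Path.Homotopic.Quotient.mk _) (Path.Homotopic.Quotient.mk _)
  rw [← Path.Homotopic.Quotient.mk_trans, h1, h2, h0]
  exact Path.Homotopic.Quotient.eq.2 h3

lemma edge_id (x : C) : edge (𝟙 x) = 𝟙 _ := by
  have h := edge_comp (𝟙 x) (𝟙 x)
  rw [Category.id_comp (𝟙 x)] at h
  rw [← cancel_epi (edge (𝟙 x)), ← h, Category.comp_id]

end NerveRealization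

/-! ### Fusion systems -/

variable {S : Type} [Group S]

/-- Conjugation `c_g : P → Q`, `x ↦ g x g⁻¹`, for `g` with `g P g⁻¹ ≤ Q`. -/
def conjHom {P Q : Subgroup S} (g : S) (h : ∀ x ∈ P, g * x * g⁻¹ ∈ Q) : P →* Q where
  toFun x := ⟨g * x * g⁻¹, h x x.2⟩
  map_one' := by simp
  map_mul' x y := by ext; simp

/-- A fusion system over `S`: a category whose objects are the subgroups of `S` and whose
morphisms are injective group homomorphisms (with the usual composition), which contains
conjugation by the elements of `S`, and in which every morphism is an isomorphism of the
category followed by an inclusion. (Identities are conjugation by `1`.) -/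
structure FusionSystem (S : Type) [Group S] where
  Hom : ∀ P Q : Subgroup S, Set (P →* Q)
  comp_mem : ∀ {P Q R : Subgroup S} {φ : P →* Q} {ψ : Q →* R},
    φ ∈ Hom P Q → ψ ∈ Hom Q R → ψ.comp φ ∈ Hom P R
  conj_mem : ∀ {P Q : Subgroup S} (g : S) (h : ∀ x ∈ P, g * x * g⁻¹ ∈ Q), conjHom g h ∈ Hom P Q
  injective : ∀ {P Q : Subgroup S} {φ : P →* Q}, φ ∈ Hom P Q → Function.Injective φ
  factor : ∀ {P Q : Subgroup S} {φ : P →* Q}, φ ∈ Hom P Q →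
    ∃ (R : Subgroup S) (hR : R ≤ Q) (e : P ≃* R),
      e.toMonoidHom ∈ Hom P R ∧ e.symm.toMonoidHom ∈ Hom R P ∧
      φ = (Subgroup.inclusion hR).comp e.toMonoidHom

namespace FusionSystem

variable (F : FusionSystem S)

/-- `e : P ≃* Q` is an isomorphism of the category `F`. -/
def IsIso {P Q : Subgroup S} (e : P ≃* Q) : Prop :=
  e.toMonoidHom ∈ F.Hom P Q ∧ e.symm.toMonoidHom ∈ F.Hom Q P

/-- `P` and `Q` are `F`-conjugate. -/
def IsConj (P Q : Subgroup S) : Prop := ∃ e : P ≃* Q, F.IsIso e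

/-- `Aut_F(P)`. -/
def aut (P : Subgroup S) : Subgroup (MulAut P) where
  carrier := {e | F.IsIso e}
  one_mem' := by
    have h : ∀ x ∈ P, (1 : S) * x * 1⁻¹ ∈ P := by simp
    have : MonoidHom.id P = conjHom 1 h := by ext; simp [conjHom]
    have h1 : MonoidHom.id P ∈ F.Hom P P := this ▸ F.conj_mem 1 h
    exact ⟨h1, h1⟩
  mul_mem' {a b} ha hb := ⟨F.comp_mem hb.1 ha.1, F.comp_mem ha.2 hb.2⟩
  inv_mem' {a} ha := ⟨ha.2, ha.1⟩

/-- `Aut_S(P)`: the automorphisms of `P` induced by conjugation by elements of `N_S(P)`. -/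
def autS (P : Subgroup S) : Subgroup (MulAut P) := P.normalizerMonoidHom.range

/-- `P` is fully automized: `Aut_S(P)` is a Sylow `p`-subgroup of `Aut_F(P)`. -/
def IsFullyAutomized (p : ℕ) (P : Subgroup S) : Prop :=
  ∃ T : Sylow p (F.aut P), (T : Subgroup (F.aut P)) = (autS P).subgroupOf (F.aut P)

/-- For `e : Q ≃* P`, the subgroup `N_e = {g ∈ N_S(Q) | e c_g e⁻¹ ∈ Aut_S(P)}` of `S`. -/
def extensionSubgroup {Q P : Subgroup S} (e : Q ≃* P) : Subgroup S :=
  (((autS P).comap (MulAut.congr e).toMonoidHom).comap Q.normalizerMonoidHom).map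
    (Subgroup.normalizer (Q : Set S)).subtype

/-- `P` is receptive: every `F`-isomorphism `e : Q → P` extends to a morphism `N_e → S` in `F`. -/
def IsReceptive (P : Subgroup S) : Prop :=
  ∀ (Q : Subgroup S) (e : Q ≃* P), F.IsIso e →
    ∃ ψ ∈ F.Hom (extensionSubgroup e) ⊤,
      ∀ (x : extensionSubgroup e) (hx : (x : S) ∈ Q), (ψ x : S) = e ⟨x, hx⟩

/-- The fusion system `F` is saturated (at the prime `p`): every subgroup of `S` is `F`-conjugate
to one that is fully automized and receptive. -/
def IsSaturated (p : ℕ) : Prop :=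
  ∀ P : Subgroup S, ∃ Q : Subgroup S, F.IsConj P Q ∧ F.IsFullyAutomized p Q ∧ F.IsReceptive Q

/-- `P` is `F`-centric: `C_S(Q) = Z(Q)` for every `Q` that is `F`-conjugate to `P`. -/
def IsCentric (P : Subgroup S) : Prop :=
  ∀ Q : Subgroup S, F.IsConj P Q →
    Subgroup.centralizer (Q : Set S) = (Subgroup.center Q).map Q.subtype

/-- `P` is fully centralized in `F`. -/
def IsFullyCentralized (P : Subgroup S) : Prop :=
  ∀ Q : Subgroup S, F.IsConj P Q →
    Nat.card (Subgroup.centralizer (Q : Set S)) ≤ Nat.card (Subgroup.centralizer (P : Set S))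

/-- The set of `F`-centric subgroups of `S`, the objects of `F^c` and of a centric linking
system. -/
structure CentricSubgroup where
  toSubgroup : Subgroup S
  isCentric : F.IsCentric toSubgroup

lemma isCentric_top [Finite S] : F.IsCentric ⊤ := by
  rintro Q ⟨e, -⟩
  obtain rfl : Q = ⊤ := by
    refine Subgroup.eq_top_of_card_eq Q ?_
    rw [← Nat.card_congr e.toEquiv, Subgroup.card_top]
  ext x
  simp only [Subgroup.mem_centralizer_iff, Subgroup.mem_map, Subgroup.mem_center_iff]
  constructor
  · intro h
    exact ⟨⟨x, trivial⟩, fun y => Subtype.ext (h y trivial), rfl⟩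
  · rintro ⟨y, hy, rfl⟩ z -
    exact congrArg Subtype.val (hy ⟨z, trivial⟩)

end FusionSystem

/-! ### Centric linking systems -/

/-- A centric linking system associated to the fusion system `F`: a finite category `L` on the
`F`-centric subgroups with functors `δ : T_S^c(S) → L` and `π : L → F`, where the morphisms
`P → Q` in the transporter category are the `g ∈ S` with `g P g⁻¹ ≤ Q`, satisfying the axioms
(A), (B) and (C). Composition `f ≫ g` is in diagrammatic order: first `f`, then `g`. -/
structure CentricLinkingSystem (F : FusionSystem S) where
  cat : Category.{0} F.CentricSubgroup
  finite_hom : ∀ P Q : F.CentricSubgroup, Finite (P ⟶ Q)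
  δ : ∀ {P Q : F.CentricSubgroup} (g : S),
    (∀ x ∈ P.toSubgroup, g * x * g⁻¹ ∈ Q.toSubgroup) → (P ⟶ Q)
  δ_one : ∀ (P : F.CentricSubgroup) (h : ∀ x ∈ P.toSubgroup, 1 * x * 1⁻¹ ∈ P.toSubgroup),
    δ 1 h = 𝟙 P
  δ_mul : ∀ {P Q R : F.CentricSubgroup} (g g' : S)
    (h : ∀ x ∈ P.toSubgroup, g * x * g⁻¹ ∈ Q.toSubgroup)
    (h' : ∀ x ∈ Q.toSubgroup, g' * x * g'⁻¹ ∈ R.toSubgroup)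
    (h'' : ∀ x ∈ P.toSubgroup, (g' * g) * x * (g' * g)⁻¹ ∈ R.toSubgroup),
    δ (g' * g) h'' = δ g h ≫ δ g' h'
  π : ∀ {P Q : F.CentricSubgroup}, (P ⟶ Q) → (P.toSubgroup →* Q.toSubgroup)
  π_mem : ∀ {P Q : F.CentricSubgroup} (f : P ⟶ Q), π f ∈ F.Hom P.toSubgroup Q.toSubgroup
  π_id : ∀ P : F.CentricSubgroup, π (𝟙 P) = MonoidHom.id P.toSubgroup
  π_comp : ∀ {P Q R : F.CentricSubgroup} (f : P ⟶ Q) (g : Q ⟶ R), π (f ≫ g) = (π g).comp (π f)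
  /-- Axiom (A): `C_S(P)` acts freely on `Mor_L(P, Q)`. -/
  free : ∀ {P Q : F.CentricSubgroup}, F.IsFullyCentralized P.toSubgroup →
    ∀ (g : S) (h : ∀ x ∈ P.toSubgroup, g * x * g⁻¹ ∈ P.toSubgroup),
      g ∈ Subgroup.centralizer (P.toSubgroup : Set S) →
      ∀ f : P ⟶ Q, δ g h ≫ f = f → g = 1
  /-- Axiom (A): `π : Mor_L(P, Q) → Hom_F(P, Q)` is onto ... -/
  π_surjective : ∀ {P Q : F.CentricSubgroup}, F.IsFullyCentralized P.toSubgroup →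
    ∀ φ ∈ F.Hom P.toSubgroup Q.toSubgroup, ∃ f : P ⟶ Q, π f = φ
  /-- Axiom (A): ... and its fibres are the orbits of `C_S(P)`. -/
  π_eq_iff : ∀ {P Q : F.CentricSubgroup}, F.IsFullyCentralized P.toSubgroup →
    ∀ f f' : P ⟶ Q, π f = π f' ↔
      ∃ (g : S) (h : ∀ x ∈ P.toSubgroup, g * x * g⁻¹ ∈ P.toSubgroup),
        g ∈ Subgroup.centralizer (P.toSubgroup : Set S) ∧ f' = δ g h ≫ f
  /-- Axiom (B). -/
  π_δ : ∀ {P Q : F.CentricSubgroup} (g : S)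
    (h : ∀ x ∈ P.toSubgroup, g * x * g⁻¹ ∈ Q.toSubgroup), π (δ g h) = conjHom g h
  /-- Axiom (C). -/
  δ_comp : ∀ {P Q : F.CentricSubgroup} (f : P ⟶ Q) (g : P.toSubgroup)
    (h : ∀ x ∈ P.toSubgroup, (g : S) * x * (g : S)⁻¹ ∈ P.toSubgroup)
    (h' : ∀ x ∈ Q.toSubgroup, (π f g : S) * x * (π f g : S)⁻¹ ∈ Q.toSubgroup),
    δ (g : S) h ≫ f = f ≫ δ (π f g : S) h'

namespace CentricLinkingSystem

variable {F : FusionSystem S} (L : CentricLinkingSystem F)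

/-- The objects of the category `L`. -/
def Obj (_L : CentricLinkingSystem F) : Type := F.CentricSubgroup

instance : Category.{0} L.Obj := L.cat

/-- The subgroup of `S` underlying an object of `L`. -/
def grp (P : L.Obj) : Subgroup S := FusionSystem.CentricSubgroup.toSubgroup P

/-- `δ_{P,Q}(g)` as a morphism of `L.Obj`. -/
def delta (P Q : L.Obj) (g : S) (h : ∀ x ∈ L.grp P, g * x * g⁻¹ ∈ L.grp Q) : P ⟶ Q :=
  L.δ g h

/-- `π(f)` as a homomorphism. -/
def piHom {P Q : L.Obj} (f : P ⟶ Q) : L.grp P →* L.grp Q := L.π f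

/-- The object `S` of `L`. -/
def top [Finite S] : L.Obj := ⟨⊤, F.isCentric_top⟩

/-- The morphism `ι_P = δ_{P,S}(1) : P → S`. -/
def ι [Finite S] (P : L.Obj) : P ⟶ L.top := L.delta P L.top 1 (fun _ _ => trivial)

/-- The geometric realization `|L|` (of the nerve of `L`). -/
noncomputable abbrev realization : TopCat.{0} := SSet.toTop.obj (nerve L.Obj)

/-- The fundamental group `π_L = π₁(|L|, S)`; the product `a * b` is "first `b`, then `a`". -/
noncomputable abbrev fundGroup [Finite S] : Type :=
  FundamentalGroup L.realization (NerveRealization.point L.top)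

/-- `ω(f) ∈ π_L`: the class of the loop `ι_Q · f · ι_P⁻¹` (first `ι_P` backwards, then `f`, then
`ι_Q`), for a morphism `f : P → Q` of `L`. -/
noncomputable def omega [Finite S] {P Q : L.Obj} (f : P ⟶ Q) : L.fundGroup :=
  Groupoid.inv (NerveRealization.edge (L.ι P)) ≫ NerveRealization.edge f ≫
    NerveRealization.edge (L.ι Q)

section
variable [Finite S]

lemma omega_comp {P Q R : L.Obj} (f : P ⟶ Q) (g : Q ⟶ R) :
    L.omega (f ≫ g) = L.omega g * L.omega f := by
  rw [End.mul_def]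
  simp [omega, NerveRealization.edge_comp]

lemma omega_id (P : L.Obj) : L.omega (𝟙 P) = 1 := by
  rw [End.one_def]
  simp [omega, NerveRealization.edge_id]

lemma ι_top : L.ι L.top = 𝟙 L.top := L.δ_one _ _

lemma omega_ι (P : L.Obj) : L.omega (L.ι P) = 1 := by
  rw [End.one_def]
  simp [omega, ι_top, NerveRealization.edge_id]

/-- The homomorphism `S → Aut_L(S) → π_L`, `g ↦ ω(δ_S(g))`. -/
noncomputable def toFundGroup : S →* L.fundGroup where
  toFun g := L.omega (L.delta L.top L.top g (fun _ _ => trivial))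
  map_one' := by
    rw [← L.omega_id L.top]
    exact congrArg L.omega (L.δ_one _ _)
  map_mul' a b := by
    rw [← L.omega_comp]
    exact congrArg L.omega (L.δ_mul b a _ _ _)

lemma omega_delta (P : L.Obj) (g : S) (h : ∀ x ∈ L.grp P, g * x * g⁻¹ ∈ L.grp P) :
    L.omega (L.delta P P g h) = L.toFundGroup g := by
  have h1 : L.delta P P g h ≫ L.ι P = L.delta P L.top g (fun _ _ => trivial) := by
    refine (L.δ_mul (R := L.top) g 1 h (fun _ _ => trivial) (fun _ _ => trivial)).symm.trans ?_
    simp [delta]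
  have h2 : L.ι P ≫ L.delta L.top L.top g (fun _ _ => trivial) =
      L.delta P L.top g (fun _ _ => trivial) := by
    refine (L.δ_mul (Q := L.top) (R := L.top) 1 g (fun _ _ => trivial) (fun _ _ => trivial)
      (fun _ _ => trivial)).symm.trans ?_
    simp [delta]
  have h3 := congrArg L.omega (h1.trans h2.symm)
  rw [omega_comp, omega_comp, omega_ι, one_mul, mul_one] at h3
  exact h3

lemma omega_mul_toFundGroup {P Q : L.Obj} (f : P ⟶ Q) (g : L.grp P) :
    L.omega f * L.toFundGroup g = L.toFundGroup (L.piHom f g : S) * L.omega f := by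
  have hP : ∀ x ∈ L.grp P, (g : S) * x * (g : S)⁻¹ ∈ L.grp P := fun x hx =>
    mul_mem (mul_mem g.2 hx) (inv_mem g.2)
  have hQ : ∀ x ∈ L.grp Q, (L.piHom f g : S) * x * (L.piHom f g : S)⁻¹ ∈ L.grp Q := fun x hx =>
    mul_mem (mul_mem (L.piHom f g).2 hx) (inv_mem (L.piHom f g).2)
  have h := congrArg L.omega (L.δ_comp f g hP hQ)
  rw [← L.omega_delta P g hP, ← L.omega_delta Q _ hQ]
  exact (L.omega_comp _ _).symm.trans (h.trans (L.omega_comp _ _))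

end

end CentricLinkingSystem

/-! ### Cohomology -/

/-- `ℤ_(p)`, the localization of `ℤ` at the prime ideal `(p)`. -/
abbrev ZLoc (p : ℕ) [Fact p.Prime] : Type :=
  haveI : (Ideal.span {(p : ℤ)}).IsPrime :=
    (Ideal.span_singleton_prime (by exact_mod_cast (Fact.out : p.Prime).ne_zero)).2
      (Nat.prime_iff_prime_int.1 Fact.out)
  Localization.AtPrime (Ideal.span {(p : ℤ)})

/-- The transfer `tr_P^S : Hⁿ(P, M) → Hⁿ(S, M)`: the inverse of the isomorphism
`Hⁿ(S, Coind_P^S M) ≅ Hⁿ(P, M)` of Shapiro's lemma, followed by the map induced by the trace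
`Coind_P^S M → M`, `f ↦ ∑ g⁻¹ f(g)` (the sum is over representatives of the cosets `P g`). -/
noncomputable def transfer {k : Type} [CommRing k] [Finite S] (P : Subgroup S) (A : Rep.{0} k S)
    (n : ℕ) : groupCohomology (Rep.res P.subtype A) n ⟶ groupCohomology A n :=
  letI : DecidableRel (QuotientGroup.rightRel P) := fun _ _ => Classical.propDecidable _
  (groupCohomology.coindIso (Rep.res P.subtype A) n).inv ≫
    (groupCohomology.functor k S n).map ((Rep.coindResAdjunction k P).counit.app A)

namespace CentricLinkingSystem

variable [Finite S] {F : FusionSystem S} (L : CentricLinkingSystem F)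
variable {k : Type} [CommRing k]

/-- A `k[π_L]`-module as a `k[S]`-module, through `S → π_L`. -/
noncomputable abbrev resS (M : Rep.{0} k L.fundGroup) : Rep.{0} k S := Rep.res L.toFundGroup M

/-- `Hⁿ(S, M)`. -/
noncomputable abbrev cohS (M : Rep.{0} k L.fundGroup) (n : ℕ) : ModuleCat.{0} k :=
  groupCohomology (L.resS M) n

/-- `Hⁿ(P, M)` for a subgroup `P` of `S`. -/
noncomputable abbrev coh (P : Subgroup S) (M : Rep.{0} k L.fundGroup) (n : ℕ) : ModuleCat.{0} k :=
  groupCohomology (Rep.res P.subtype (L.resS M)) n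

/-- The restriction `Res_P^S : Hⁿ(S, M) → Hⁿ(P, M)`. -/
noncomputable def restrict (P : Subgroup S) (M : Rep.{0} k L.fundGroup) (n : ℕ) :
    L.cohS M n ⟶ L.coh P M n :=
  groupCohomology.map P.subtype (𝟙 (Rep.res P.subtype (L.resS M))) n

/-- For an automorphism `ψ` of the object `Q` of `L` and subgroups `P` and `P'` of `Q` with
`π(ψ)(P) = P'`, the homomorphism `P → P'` obtained by restricting `π(ψ)`. -/
def stepHom {P P' : Subgroup S} {Q : L.Obj} (ψ : Aut Q) (hP : P ≤ L.grp Q)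
    (h : (P.subgroupOf (L.grp Q)).map (L.piHom ψ.hom) = P'.subgroupOf (L.grp Q)) : P →* P' where
  toFun x := ⟨L.piHom ψ.hom ⟨x, hP x.2⟩, by
    have : L.piHom ψ.hom ⟨x, hP x.2⟩ ∈ P'.subgroupOf (L.grp Q) :=
      h ▸ Subgroup.mem_map_of_mem _ (Subgroup.mem_subgroupOf.2 x.2)
    exact Subgroup.mem_subgroupOf.1 this⟩
  map_one' := Subtype.ext (congrArg (Subtype.val : L.grp Q → S) (map_one (L.piHom ψ.hom)))
  map_mul' x y := Subtype.ext (congrArg (Subtype.val : L.grp Q → S)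
    (map_mul (L.piHom ψ.hom) ⟨x, hP x.2⟩ ⟨y, hP y.2⟩))

/-- The map `ω(ψ)⁻¹ : M → M`, which is equivariant along `stepHom`. -/
noncomputable def stepRepHom {P P' : Subgroup S} {Q : L.Obj} (ψ : Aut Q) (hP : P ≤ L.grp Q)
    (h : (P.subgroupOf (L.grp Q)).map (L.piHom ψ.hom) = P'.subgroupOf (L.grp Q))
    (M : Rep.{0} k L.fundGroup) :
    Rep.res (L.stepHom ψ hP h) (Rep.res P'.subtype (L.resS M)) ⟶
      Rep.res P.subtype (L.resS M) :=
  Rep.ofHom ⟨M.ρ (L.omega ψ.hom)⁻¹, fun g => by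
    have e := L.omega_mul_toFundGroup ψ.hom ⟨g, hP g.2⟩
    have e' : (L.omega ψ.hom)⁻¹ * L.toFundGroup (L.stepHom ψ hP h g : S) =
        L.toFundGroup g * (L.omega ψ.hom)⁻¹ := by
      rw [inv_mul_eq_iff_eq_mul, ← mul_assoc, eq_mul_inv_iff_mul_eq]
      exact e.symm
    have e'' := congrArg M.ρ e'
    rw [map_mul, map_mul] at e''
    exact e''⟩

/-- The map `H^*(π(ψ)|, ω(ψ)⁻¹) : Hⁿ(P', M) → Hⁿ(P, M)`. -/
noncomputable def stepMap {P P' : Subgroup S} {Q : L.Obj} (ψ : Aut Q) (hP : P ≤ L.grp Q)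
    (h : (P.subgroupOf (L.grp Q)).map (L.piHom ψ.hom) = P'.subgroupOf (L.grp Q))
    (M : Rep.{0} k L.fundGroup) (n : ℕ) : L.coh P' M n ⟶ L.coh P M n :=
  groupCohomology.map (L.stepHom ψ hP h) (L.stepRepHom ψ hP h M) n

/-- Sequences `P = P₀, P₁, …, P_r = R` of subgroups of `S`, with `F`-centric subgroups
`Q₁, …, Q_r` and automorphisms `ψᵢ ∈ Aut_L(Qᵢ)` such that `Pᵢ₋₁, Pᵢ ≤ Qᵢ` and
`π(ψᵢ)(Pᵢ₋₁) = Pᵢ`. -/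
inductive Chain : Subgroup S → Subgroup S → Type
  | nil (P : Subgroup S) : Chain P P
  | cons {P P' R : Subgroup S} {Q : L.Obj} (ψ : Aut Q) (hP : P ≤ L.grp Q) (hP' : P' ≤ L.grp Q)
      (h : (P.subgroupOf (L.grp Q)).map (L.piHom ψ.hom) = P'.subgroupOf (L.grp Q))
      (c : Chain P' R) : Chain P R

variable {L}

/-- The composite `π(ψ_r)| ∘ ⋯ ∘ π(ψ₁)| : P → R`. -/
def Chain.hom : ∀ {P R : Subgroup S}, L.Chain P R → (P →* R)
  | _, _, .nil P => MonoidHom.id P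
  | _, _, .cons ψ hP _ h c => (Chain.hom c).comp (L.stepHom ψ hP h)

/-- The composite `H^*(π(ψ₁)|, ω(ψ₁)⁻¹) ∘ ⋯ ∘ H^*(π(ψ_r)|, ω(ψ_r)⁻¹) : Hⁿ(R, M) → Hⁿ(P, M)`. -/
noncomputable def Chain.cohMap (M : Rep.{0} k L.fundGroup) (n : ℕ) :
    ∀ {P R : Subgroup S}, L.Chain P R → (L.coh R M n ⟶ L.coh P M n)
  | _, _, .nil P => 𝟙 (L.coh P M n)
  | _, _, .cons ψ hP _ h c => Chain.cohMap M n c ≫ L.stepMap ψ hP h M n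

end CentricLinkingSystem

/-! ### Bisets -/

section Biset

variable (S) (Ω : Type) [MulAction S Ω] [MulAction Sᵐᵒᵖ Ω] [SMulCommClass S Sᵐᵒᵖ Ω]

/-- Two points of an `(S, S)`-biset lie in the same transitive component. Here `S` acts on the
left, and `x · b` is `MulOpposite.op b • x`. -/
def bisetSetoid : Setoid Ω where
  r x y := ∃ a b : S, y = a • MulOpposite.op b • x
  iseqv :=
    { refl := fun x => ⟨1, 1, by simp⟩
      symm := by
        rintro x y ⟨a, b, rfl⟩
        exact ⟨a⁻¹, b⁻¹, by rw [smul_comm a (MulOpposite.op b) x]; simp⟩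
      trans := by
        rintro x y z ⟨a, b, rfl⟩ ⟨a', b', rfl⟩
        exact ⟨a' * a, b * b', by
          rw [← smul_comm a, smul_smul, smul_smul, ← MulOpposite.op_mul]⟩ }

/-- The set of transitive components of an `(S, S)`-biset. -/
def BisetComponent : Type := Quotient (bisetSetoid S Ω)

end Biset

section Biset

variable {Ω : Type} [MulAction S Ω] [MulAction Sᵐᵒᵖ Ω] [SMulCommClass S Sᵐᵒᵖ Ω]

/-- `Δ(P, φ) = {(u, φ(u)) | u ∈ P} ≤ S × S`. -/
def graphSubgroup (P : Subgroup S) (φ : P →* S) : Subgroup (S × S) := (P.subtype.prod φ).range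

/-- The transitive component `c` of the biset is isomorphic to `[P, φ] = (S × S)/Δ(P, φ)`,
with `a · z · b = (a, b⁻¹) z` for `z ∈ (S × S)/Δ(P, φ)`. -/
def BisetComponent.IsIsoTo (c : BisetComponent S Ω) (P : Subgroup S) (φ : P →* S) : Prop :=
  ∃ e : ((S × S) ⧸ graphSubgroup P φ) ≃ {x : Ω // Quotient.mk (bisetSetoid S Ω) x = c},
    ∀ (a b : S) (z : (S × S) ⧸ graphSubgroup P φ),
      (e ((a, b⁻¹) • z) : Ω) = a • MulOpposite.op b • (e z : Ω)

variable (Ω) in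
/-- `Ω` is an `F`-characteristic `(S, S)`-biset. -/
structure FusionSystem.IsCharacteristic (F : FusionSystem S) (p : ℕ) : Prop where
  /-- `Ω` is left-free. -/
  left_free : ∀ (a : S) (x : Ω), a • x = x → a = 1
  /-- `Ω` is `F`-generated: it is a union of bisets `[P, φ]` with `φ ∈ Hom_F(P, S)`. -/
  generated : ∀ c : BisetComponent S Ω, ∃ (P : Subgroup S), ∃ φ ∈ F.Hom P ⊤,
    c.IsIsoTo P ((⊤ : Subgroup S).subtype.comp φ)
  /-- `Ω` is left-`F`-stable: `_φΩ_S ≅ _PΩ_S` as `(P, S)`-bisets. -/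
  left_stable : ∀ (P : Subgroup S), ∀ φ ∈ F.Hom P ⊤, ∃ e : Ω ≃ Ω, ∀ (u : P) (s : S) (x : Ω),
    e ((φ u : S) • MulOpposite.op s • x) = (u : S) • MulOpposite.op s • e x
  /-- `Ω` is right-`F`-stable: `_SΩ_φ ≅ _SΩ_P` as `(S, P)`-bisets. -/
  right_stable : ∀ (P : Subgroup S), ∀ φ ∈ F.Hom P ⊤, ∃ e : Ω ≃ Ω, ∀ (u : P) (s : S) (x : Ω),
    e (s • MulOpposite.op (φ u : S) • x) = s • MulOpposite.op (u : S) • e x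
  /-- `Ω` is non degenerate: `|Ω|/|S|` (an integer, as `Ω` is left-free) is not `0` modulo `p`. -/
  nondegenerate : ¬ p ∣ Nat.card Ω / Nat.card S

variable [Finite S] {F : FusionSystem S}

/-- The choices that define an `Ω`-endomorphism: for each transitive component of `Ω`, a pair
`(P, φ)` such that the component is isomorphic to `[P, φ]`, and a decomposition
`φ = incl ∘ π(ψ_r)| ∘ ⋯ ∘ π(ψ₁)|` of `φ` into restrictions of automorphisms of centric
subgroups. -/
structure OmegaEndomorphism (L : CentricLinkingSystem F) (Ω : Type) [MulAction S Ω]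
    [MulAction Sᵐᵒᵖ Ω] [SMulCommClass S Sᵐᵒᵖ Ω] where
  P : BisetComponent S Ω → Subgroup S
  R : BisetComponent S Ω → Subgroup S
  chain : ∀ c, L.Chain (P c) (R c)
  isIsoTo : ∀ c : BisetComponent S Ω, c.IsIsoTo (P c) ((R c).subtype.comp (chain c).hom)

namespace OmegaEndomorphism

variable {L : CentricLinkingSystem F} (w : OmegaEndomorphism L Ω)

/-- The endomorphism `ω_n = ∑ tr_P^S ∘ (composite along the decomposition) ∘ Res_{φ(P)}^S` of
`Hⁿ(S, M)`; the sum is over the transitive components of `Ω` (it is finite if `Ω` is). -/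
noncomputable def app {k : Type} [CommRing k] (M : Rep.{0} k L.fundGroup) (n : ℕ) :
    End (L.cohS M n) :=
  ∑ᶠ c : BisetComponent S Ω,
    L.restrict (w.R c) M n ≫ (w.chain c).cohMap M n ≫ transfer (w.P c) (L.resS M) n

variable (p : ℕ) [Fact p.Prime]

/-- `(|S|/|Ω|) ω_n`, where `|S|/|Ω| ∈ ℤ_(p)` is the inverse of the integer `|Ω|/|S|`, which is
prime to `p`. -/
noncomputable def normalized (M : Rep.{0} (ZLoc p) L.fundGroup) (n : ℕ) : End (L.cohS M n) :=
  Ring.inverse (((Nat.card Ω / Nat.card S : ℕ) : ZLoc p)) • w.app M n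

/-- The numbers `N n M = N_{n,M}` are positive, and the `N_{n,M}`-th power of `(|S|/|Ω|) ω_n` is
an idempotent of `Hⁿ(S, M)`, for every finite `M` and every `n`. -/
def IsIdempotentExponent (N : ℕ → Rep.{0} (ZLoc p) L.fundGroup → ℕ) : Prop :=
  ∀ (n : ℕ) (M : Rep.{0} (ZLoc p) L.fundGroup), Finite M →
    0 < N n M ∧ IsIdempotentElem (w.normalized p M n ^ N n M)

/-- The `F^c`-characteristic idempotent `ω̄_{n,M} = ((|S|/|Ω|) ω_n)^(N_{0,M} ⋯ N_{n,M})`. -/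
noncomputable def charIdempotent (N : ℕ → Rep.{0} (ZLoc p) L.fundGroup → ℕ)
    (M : Rep.{0} (ZLoc p) L.fundGroup) (n : ℕ) : End (L.cohS M n) :=
  w.normalized p M n ^ ∏ i ∈ Finset.range (n + 1), N i M

end OmegaEndomorphism

/-- The family `η` is an endomorphism of the `δ`-functor `(H^*(S, -), δ)` on the category of
finite `k[π_L]`-modules. -/
structure CentricLinkingSystem.IsDeltaEndomorphism (L : CentricLinkingSystem F) {k : Type}
    [CommRing k] (η : ∀ (M : Rep.{0} k L.fundGroup) (n : ℕ), End (L.cohS M n)) : Prop where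
  /-- Naturality in the module. -/
  natural : ∀ (n : ℕ) (M N : Rep.{0} k L.fundGroup), Finite M → Finite N → ∀ f : M ⟶ N,
    (groupCohomology.functor k S n).map ((Rep.resFunctor L.toFundGroup).map f) ≫ η N n =
      η M n ≫ (groupCohomology.functor k S n).map ((Rep.resFunctor L.toFundGroup).map f)
  /-- Compatibility with the connecting homomorphisms of short exact sequences. -/
  comm_δ : ∀ (X : ShortComplex (Rep.{0} k L.fundGroup)) (hX : X.ShortExact),
    Finite X.X₁ → Finite X.X₂ → Finite X.X₃ → ∀ n : ℕ,
    groupCohomology.δ ((Rep.shortExact_res L.toFundGroup).2 hX) n (n + 1) rfl ≫ η X.X₁ (n + 1) =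
      η X.X₃ n ≫ groupCohomology.δ ((Rep.shortExact_res L.toFundGroup).2 hX) n (n + 1) rfl

end Biset

/-! The point is to work on cochains. Restriction, the twisted maps
$H^*(\pi(\psi),\omega(\psi)^{-1})$ and the transfer are all induced by cochain maps natural in the
$\pi_{\mathcal L}$-module $M$. So $\omega_k=H^k(\theta_M)$ for one natural endomorphism $\theta$ of
$M\mapsto C^*(S,M)$ (`exists_natTrans_app`). As $C^*(S,-)$ is exact, $\omega_*$ commutes with $f_*$
and with connecting maps, and so does any scalar multiple of it.

The transfer is the delicate term, because the Shapiro isomorphism goes through Ext. Its inverse is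
computed by a comparison between two resolutions of the trivial $P$-module, the bar resolution of
$P$ and the restricted bar resolution of the whole group. This comparison does not involve the
coefficients, hence the naturality (`exists_natTrans_coindIso_inv`).

The rest is about powers. $H^k(S,M)$ is finite, so every endomorphism has an idempotent positive
power, which does not depend on the exponent chosen. Two intertwined endomorphisms can thus be
raised to a common exponent, so their idempotent powers are intertwined too
(`End.comp_pow_eq_pow_comp_of_isIdempotentElem`). -/

/-! ### Ext computed from two projective resolutions -/

section LinearYoneda

variable {R : Type*} [Ring R] {C : Type*} [Category* C] [Abelian C] [Linear R C]

namespace ChainComplex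

/-- Precomposition with a chain map, as a morphism of cochain complexes `Hom(Q, Y) ⟶ Hom(P, Y)`. -/
noncomputable def linearYonedaObjPrecomp {P Q : ChainComplex C ℕ} (φ : P ⟶ Q) (Y : C) :
    Q.linearYonedaObj R Y ⟶ P.linearYonedaObj R Y :=
  (HomologicalComplex.unopFunctor _ _).map
    ((((linearYoneda R C).obj Y).rightOp.mapHomologicalComplex _).map φ).op

/-- Postcomposition with a morphism, as a morphism of cochain complexes
`Hom(P, Y) ⟶ Hom(P, Y')`. -/
noncomputable def linearYonedaObjPostcomp (P : ChainComplex C ℕ) {Y Y' : C} (f : Y ⟶ Y') :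
    P.linearYonedaObj R Y ⟶ P.linearYonedaObj R Y' where
  f i := ((linearYoneda R C).map f).app (Opposite.op (P.X i))
  comm' i j _ := (((linearYoneda R C).map f).naturality (P.d j i).op).symm

lemma linearYonedaObjPostcomp_comp_precomp {P Q : ChainComplex C ℕ} (φ : P ⟶ Q) {Y Y' : C}
    (f : Y ⟶ Y') :
    linearYonedaObjPostcomp Q f ≫ linearYonedaObjPrecomp φ Y' =
      linearYonedaObjPrecomp (R := R) φ Y ≫ linearYonedaObjPostcomp P f := by
  ext i : 1
  exact (((linearYoneda R C).map f).naturality (φ.f i).op).symm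

end ChainComplex

variable [EnoughProjectives C]

/-- The two computations of `Ext` from projective resolutions `P` and `Q` differ by the map
induced by any comparison `Q ⟶ P`. -/
lemma CategoryTheory.ProjectiveResolution.isoExt_inv_comp_isoExt_hom {X : C}
    (P Q : ProjectiveResolution X) (φ : Q.complex ⟶ P.complex)
    (hφ : φ.f 0 ≫ P.π.f 0 = Q.π.f 0) (n : ℕ) (Y : C) :
    (P.isoExt (R := R) n Y).inv ≫ (Q.isoExt n Y).hom =
      HomologicalComplex.homologyMap (ChainComplex.linearYonedaObjPrecomp φ Y) n := by
  have h := ProjectiveResolution.isoLeftDerivedObj_hom_naturality (𝟙 X) Q P φ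
    (hφ.trans (Category.comp_id _).symm) ((linearYoneda R C).obj Y).rightOp n
  rw [Functor.map_id, Category.id_comp] at h
  -- `isoExt` is a left derived functor in the opposite category, followed by the identification of
  -- opposite homology with homology. The cancellation is stated for arbitrary modules so that the
  -- `unop` of each equality fits up to unfolding.
  have cancel {A B D E T : ModuleCat R} {a : A ⟶ B} {b : B ⟶ D} {c : D ⟶ E} {d : E ⟶ T}
      {t : B ⟶ E} {m : A ⟶ T} {a' : T ⟶ E} (h₁ : b ≫ c = t) (h₂ : a ≫ t = m ≫ a')
      (h₃ : a' ≫ d = 𝟙 T) : (a ≫ b) ≫ c ≫ d = m := by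
    rw [Category.assoc, reassoc_of% h₁, reassoc_of% h₂, h₃, Category.comp_id]
  exact cancel (congrArg Quiver.Hom.unop ((Iso.inv_comp_eq _).2 h))
    (congrArg Quiver.Hom.unop (HomologicalComplex.homologyOp_hom_naturality
      (ChainComplex.linearYonedaObjPrecomp (R := R) φ Y) n))
    (congrArg Quiver.Hom.unop
      (HomologicalComplex.homologyOp (Q.complex.linearYonedaObj R Y) n).inv_hom_id)

end LinearYoneda

/-! ### Shapiro's lemma on cochains -/

namespace groupCohomology

open Rep

variable {k G : Type} [CommRing k] [Group G]

lemma inhomogeneousCochainsIso_inv_naturality {A B : Rep.{0} k G} (f : A ⟶ B) :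
    (inhomogeneousCochainsIso A).inv ≫ cochainsMap (MonoidHom.id G) f =
      (barComplex k G).linearYonedaObjPostcomp f ≫ (inhomogeneousCochainsIso B).inv := by
  ext i : 1
  rfl

lemma inhomogeneousCochainsIso_hom_naturality {A B : Rep.{0} k G} (f : A ⟶ B) :
    cochainsMap (MonoidHom.id G) f ≫ (inhomogeneousCochainsIso B).hom =
      (inhomogeneousCochainsIso A).hom ≫ (barComplex k G).linearYonedaObjPostcomp f := by
  rw [← Iso.inv_comp_eq, ← Category.assoc, inhomogeneousCochainsIso_inv_naturality,
    Category.assoc, Iso.inv_hom_id, Category.comp_id]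

/-- Naturality in the coefficients of
$\mathrm{Hom}_P(\mathrm{Res}\,Q_i,A)\cong\mathrm{Hom}_G(Q_i,\mathrm{Coind}\,A)$, the cochain form of
Shapiro's lemma. -/
lemma linearYonedaObjResProjectiveResolutionIso_hom_naturality {P : Subgroup G}
    (Q : ProjectiveResolution (Rep.trivial k G k)) {A B : Rep.{0} k P} (f : A ⟶ B) :
    ChainComplex.linearYonedaObjPostcomp _ f ≫
        (linearYonedaObjResProjectiveResolutionIso Q B).hom =
      (linearYonedaObjResProjectiveResolutionIso Q A).hom ≫
        ChainComplex.linearYonedaObjPostcomp _ (coindMap P.subtype f) := by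
  ext i : 1
  rfl

/-- The inverse of the isomorphism of Shapiro's lemma is induced by a natural map of
cochain complexes. -/
lemma exists_natTrans_coindIso_inv (P : Subgroup G) :
    ∃ θ : cochainsFunctor k P ⟶ coindFunctor k P.subtype ⋙ cochainsFunctor k G,
      ∀ (A : Rep.{0} k P) (n : ℕ), (coindIso A n).inv =
        HomologicalComplex.homologyMap (θ.app A) n := by
  let B := barResolution k G
  let Q : ProjectiveResolution (Rep.trivial k P k) :=
    (resFunctor P.subtype).mapProjectiveResolution B
  -- A comparison over the identity of the trivial module, chosen once for all coefficients $A$.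
  let φ : Q.complex ⟶ (barResolution k P).complex :=
    ProjectiveResolution.lift (𝟙 _) Q (barResolution k P)
  have hφ : φ.f 0 ≫ (barResolution k P).π.f 0 = Q.π.f 0 :=
    (ProjectiveResolution.lift_commutes_zero (𝟙 _) Q (barResolution k P)).trans
      (Category.comp_id _)
  -- Pasting of four commutative squares, one for each factor of $\theta_A$.
  have assoc₄ {X₁ X₂ X₃ X₄ X₅ : CochainComplex (ModuleCat k) ℕ}
      {X₁' X₂' X₃' X₄' X₅' : CochainComplex (ModuleCat k) ℕ}
      {a : X₁ ⟶ X₂} {b : X₂ ⟶ X₃} {c : X₃ ⟶ X₄} {d : X₄ ⟶ X₅}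
      {a' : X₁' ⟶ X₂'} {b' : X₂' ⟶ X₃'} {c' : X₃' ⟶ X₄'} {d' : X₄' ⟶ X₅'}
      {t₁ : X₁ ⟶ X₁'} {t₂ : X₂ ⟶ X₂'} {t₃ : X₃ ⟶ X₃'} {t₄ : X₄ ⟶ X₄'} {t₅ : X₅ ⟶ X₅'}
      (h₁ : t₁ ≫ a' = a ≫ t₂) (h₂ : t₂ ≫ b' = b ≫ t₃) (h₃ : t₃ ≫ c' = c ≫ t₄)
      (h₄ : d ≫ t₅ = t₄ ≫ d') :
      t₁ ≫ a' ≫ b' ≫ c' ≫ d' = (a ≫ b ≫ c ≫ d) ≫ t₅ := by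
    simp only [Category.assoc, h₄, reassoc_of% h₁, reassoc_of% h₂, reassoc_of% h₃]
  -- $C^*(P,A)\cong\mathrm{Hom}_P(\mathrm{Bar}\,P,A)\to\mathrm{Hom}_P(\mathrm{Res}\,\mathrm{Bar}\,G,A)\cong\mathrm{Hom}_G(\mathrm{Bar}\,G,\mathrm{Coind}\,A)\cong
  -- C^*(G,\mathrm{Coind}\,A)$.
  refine ⟨{ app A := (inhomogeneousCochainsIso A).hom ≫
              ChainComplex.linearYonedaObjPrecomp φ A ≫
              (linearYonedaObjResProjectiveResolutionIso B A).hom ≫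
              (inhomogeneousCochainsIso (coind P.subtype A)).inv
            naturality A A' f := assoc₄ (inhomogeneousCochainsIso_hom_naturality f)
              (ChainComplex.linearYonedaObjPostcomp_comp_precomp φ f)
              (linearYonedaObjResProjectiveResolutionIso_hom_naturality B f)
              (inhomogeneousCochainsIso_inv_naturality (coindMap P.subtype f)) }, fun A n => ?_⟩
  have h := ProjectiveResolution.isoExt_inv_comp_isoExt_hom (R := k) (barResolution k P) Q φ hφ
    n A
  -- The only factor of `coindIso` that passes through Ext; the comparison $\varphi$ brings it back
  -- to cochains.
  have h' : (groupCohomologyIso A n Q).hom =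
      HomologicalComplex.homologyMap (inhomogeneousCochainsIso A).hom n ≫
        HomologicalComplex.homologyMap (ChainComplex.linearYonedaObjPrecomp φ A) n :=
    congrArg (fun t => HomologicalComplex.homologyMap (inhomogeneousCochainsIso A).hom n ≫ t) h
  refine (congrArg (fun t => t ≫ HomologicalComplex.homologyMap
    ((linearYonedaObjResProjectiveResolutionIso B A).hom ≫
      (inhomogeneousCochainsIso (coind P.subtype A)).inv) n) h').trans ?_
  refine (Category.assoc _ _ _).trans ?_
  refine Eq.trans ?_ (HomologicalComplex.homologyMap_comp _ _ _).symm
  exact congrArg (fun t => _ ≫ t) (HomologicalComplex.homologyMap_comp _ _ _).symm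

end groupCohomology

/-! ### Idempotent powers -/

section Powers

/-- By pigeonhole $x^i=x^j$ with $i<j$, so from exponent $i$ on the powers have period $j-i$. A
multiple of the period that is at least $i$ works. -/
lemma exists_pos_isIdempotentElem_pow {M : Type*} [Monoid M] [Finite M] (x : M) :
    ∃ n : ℕ, 0 < n ∧ IsIdempotentElem (x ^ n) := by
  obtain ⟨i, j, hij, h⟩ : ∃ i j : ℕ, i < j ∧ x ^ i = x ^ j := by
    obtain ⟨i, j, hne, h⟩ := Finite.exists_ne_map_eq_of_infinite (fun n : ℕ => x ^ n)
    rcases hne.lt_or_gt with hlt | hlt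
    exacts [⟨i, j, hlt, h⟩, ⟨j, i, hlt, h.symm⟩]
  have step (m : ℕ) (hm : i ≤ m) (t : ℕ) : x ^ (m + t * (j - i)) = x ^ m := by
    induction t with
    | zero => simp
    | succ t ih =>
      rw [show m + (t + 1) * (j - i) = j + (m - i + t * (j - i)) by
        rw [add_mul, one_mul]; omega, pow_add, ← h, ← pow_add, ← ih]
      congr 1
      omega
  have hpos : 0 < j - i := by omega
  -- The factor $i+1$, rather than $i$, keeps the exponent positive when $i=0$.
  refine ⟨(i + 1) * (j - i), by positivity, ?_⟩
  rw [IsIdempotentElem, ← pow_add]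
  exact step _ (by nlinarith) _

/-- Positive powers of an idempotent are itself; `0 < m` excludes the zeroth power, which is $1$. -/
lemma IsIdempotentElem.pow_eq_of_dvd {M : Type*} [Monoid M] {x : M} {n m : ℕ}
    (h : IsIdempotentElem (x ^ n)) (hm : 0 < m) (hnm : n ∣ m) : x ^ m = x ^ n := by
  obtain ⟨c, rfl⟩ := hnm
  obtain ⟨c, rfl⟩ := Nat.exists_eq_succ_of_ne_zero (Nat.pos_of_mul_pos_left hm).ne'
  rw [pow_mul, h.pow_succ_eq]

namespace CategoryTheory

variable {C : Type*} [Category* C] {A B : C} {f : A ⟶ B} {a : End A} {b : End B}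

lemma End.comp_pow_eq_pow_comp (h : f ≫ b = a ≫ f) (m : ℕ) :
    f ≫ (b ^ m : End B) = (a ^ m : End A) ≫ f := by
  induction m with
  | zero => simp [End.one_def]
  | succ m ih =>
    rw [pow_succ, pow_succ, End.mul_def, End.mul_def, reassoc_of% h, ih, Category.assoc]

lemma End.comp_smul_eq_smul_comp {R : Type*} [Semiring R] [Preadditive C] [Linear R C]
    (h : f ≫ b = a ≫ f) (r : R) : f ≫ (r • b : End B) = (r • a : End A) ≫ f :=
  (Linear.comp_smul _ _ _ f r b).trans
    ((congrArg (r • ·) h).trans (Linear.smul_comp _ _ _ r a f).symm)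

/-- The exponents on the two sides may differ, as they depend on the module and the degree. Passing
to the common exponent $ij$ changes neither idempotent. -/
lemma End.comp_pow_eq_pow_comp_of_isIdempotentElem (h : f ≫ b = a ≫ f) {i j : ℕ}
    (hi : 0 < i) (hj : 0 < j) (ha : IsIdempotentElem (a ^ i)) (hb : IsIdempotentElem (b ^ j)) :
    f ≫ (b ^ j : End B) = (a ^ i : End A) ≫ f := by
  have hij : 0 < i * j := Nat.mul_pos hi hj
  rw [← ha.pow_eq_of_dvd hij (Dvd.intro _ rfl), ← hb.pow_eq_of_dvd hij (Dvd.intro_left _ rfl)]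
  exact End.comp_pow_eq_pow_comp h _

end CategoryTheory

end Powers

/-! ### Finiteness of cohomology -/

/-- Cohomology is a subquotient of the finite module of functions $G^n\to A$. -/
lemma groupCohomology.finite {k G : Type} [CommRing k] [Group G] [Finite G] (A : Rep.{0} k G)
    [Finite A] (n : ℕ) : Finite (groupCohomology A n) := by
  have : Finite ((inhomogeneousCochains A).X n) := inferInstanceAs (Finite ((Fin n → G) → A))
  have : Finite (cocycles A n) := Finite.of_injective (iCocycles A n)
    ((ModuleCat.mono_iff_injective (iCocycles A n)).1 inferInstance)
  exact Finite.of_surjective (π A n)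
    ((ModuleCat.epi_iff_surjective (π A n)).1
      (inferInstanceAs (Epi ((inhomogeneousCochains A).homologyπ n))))

lemma ModuleCat.finite_end {k : Type*} [Ring k] (V : ModuleCat k) [Finite V] :
    Finite (End V) :=
  Finite.of_injective (fun f : End V => (ModuleCat.Hom.hom f : V → V)) fun _ _ h =>
    ModuleCat.hom_ext (LinearMap.ext (congrFun h))

/-! ### Restriction, twisted maps and transfer on cochains -/

section CochainTransformations

open groupCohomology

variable {S : Type} [Group S] [Finite S]

/-- The inverse Shapiro map is natural on cochains, and the trace is the counit of an adjunction,
hence natural in $A$. -/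
lemma exists_natTrans_transfer {k : Type} [CommRing k] (P : Subgroup S) :
    ∃ θ : Rep.resFunctor P.subtype ⋙ cochainsFunctor k P ⟶ cochainsFunctor k S,
      ∀ (A : Rep.{0} k S) (n : ℕ),
        transfer P A n = HomologicalComplex.homologyMap (θ.app A) n := by
  obtain ⟨θ, hθ⟩ := exists_natTrans_coindIso_inv (k := k) P
  -- The same instance as in `transfer`, so that the two counits agree.
  let dec : DecidableRel (QuotientGroup.rightRel P) := fun _ _ => Classical.propDecidable _
  refine ⟨Functor.whiskerLeft (Rep.resFunctor P.subtype) θ ≫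
    Functor.whiskerRight (Rep.coindResAdjunction k P).counit (cochainsFunctor k S), fun A n => ?_⟩
  refine (congrArg (fun t => t ≫ (groupCohomology.functor k S n).map
    ((Rep.coindResAdjunction k P).counit.app A)) (hθ (Rep.res P.subtype A) n)).trans ?_
  exact (HomologicalComplex.homologyMap_comp _ _ _).symm

namespace CentricLinkingSystem

variable {F : FusionSystem S} (L : CentricLinkingSystem F) (k : Type) [CommRing k]

/-- The cochains on `S`, as a functor of the `k[π_L]`-module. -/
noncomputable abbrev cochainsS : Rep.{0} k L.fundGroup ⥤ CochainComplex (ModuleCat.{0} k) ℕ :=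
  Rep.resFunctor L.toFundGroup ⋙ cochainsFunctor k S

/-- The cochains on a subgroup of `S`, as a functor of the `k[π_L]`-module. -/
noncomputable abbrev cochainsOn (P : Subgroup S) :
    Rep.{0} k L.fundGroup ⥤ CochainComplex (ModuleCat.{0} k) ℕ :=
  Rep.resFunctor L.toFundGroup ⋙ Rep.resFunctor P.subtype ⋙ cochainsFunctor k P

/-- The cochain map inducing `restrict`. -/
noncomputable def restrictCochains (P : Subgroup S) : L.cochainsS k ⟶ L.cochainsOn k P where
  app M := cochainsMap P.subtype (𝟙 (Rep.res P.subtype (L.resS M)))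
  naturality M N f := by
    ext i : 1
    rfl

variable {L}

/-- The cochain map inducing `stepMap`. -/
noncomputable def stepCochains {P P' : Subgroup S} {Q : L.Obj} (ψ : Aut Q) (hP : P ≤ L.grp Q)
    (h : (P.subgroupOf (L.grp Q)).map (L.piHom ψ.hom) = P'.subgroupOf (L.grp Q)) :
    L.cochainsOn k P' ⟶ L.cochainsOn k P where
  app M := cochainsMap (L.stepHom ψ hP h) (L.stepRepHom ψ hP h M)
  naturality M N f := by
    ext i x
    funext g
    -- This uses that $f$ is $\pi_{\mathcal L}$-linear; $S$-linearity alone would not give it.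
    exact (Rep.hom_comm_apply f (L.omega ψ.hom)⁻¹ _).symm

/-- The cochain map inducing `Chain.cohMap`. -/
noncomputable def Chain.cochainMap :
    ∀ {P R : Subgroup S}, L.Chain P R → (L.cochainsOn k R ⟶ L.cochainsOn k P)
  | _, _, .nil P => 𝟙 (L.cochainsOn k P)
  | _, _, .cons ψ hP _ h c => Chain.cochainMap c ≫ stepCochains k ψ hP h

variable {k}

lemma Chain.cohMap_eq_homologyMap (M : Rep.{0} k L.fundGroup) (n : ℕ) {P R : Subgroup S}
    (c : L.Chain P R) :
    c.cohMap M n = HomologicalComplex.homologyMap ((c.cochainMap k).app M) n := by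
  induction c with
  | nil P => exact (HomologicalComplex.homologyMap_id _ _).symm
  | cons ψ hP hP' h c ih =>
    refine (congrArg (fun t => t ≫ L.stepMap ψ hP h M n) ih).trans ?_
    exact (HomologicalComplex.homologyMap_comp _ _ _).symm

end CentricLinkingSystem

end CochainTransformations

/-! ### The endomorphism on cochains -/

section Main

open groupCohomology

variable {S : Type} [Group S] [Finite S] {F : FusionSystem S} {L : CentricLinkingSystem F}
  {Ω : Type} [Finite Ω] [MulAction S Ω] [MulAction Sᵐᵒᵖ Ω] [SMulCommClass S Sᵐᵒᵖ Ω]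

namespace OmegaEndomorphism

/-- An `Ω`-endomorphism is induced by a natural endomorphism of the cochain complexes. -/
lemma exists_natTrans_app (w : OmegaEndomorphism L Ω) (k : Type) [CommRing k] :
    ∃ θ : L.cochainsS k ⟶ L.cochainsS k, ∀ (M : Rep.{0} k L.fundGroup) (n : ℕ),
      w.app M n = HomologicalComplex.homologyMap (θ.app M) n := by
  -- With finitely many components, `∑ᶠ` is an honest sum rather than possibly its default value
  -- $0$, and additivity of homology applies.
  have : Finite (BisetComponent S Ω) := inferInstanceAs (Finite (Quotient _))
  have := Fintype.ofFinite (BisetComponent S Ω)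
  choose τ hτ using fun P : Subgroup S => exists_natTrans_transfer (k := k) P
  let θ (c : BisetComponent S Ω) : L.cochainsS k ⟶ L.cochainsS k :=
    L.restrictCochains k (w.R c) ≫ (w.chain c).cochainMap k ≫
      Functor.whiskerLeft (Rep.resFunctor L.toFundGroup) (τ (w.P c))
  have hθ (c : BisetComponent S Ω) (M : Rep.{0} k L.fundGroup) (n : ℕ) :
      L.restrict (w.R c) M n ≫ (w.chain c).cohMap M n ≫ transfer (w.P c) (L.resS M) n =
        HomologicalComplex.homologyMap ((θ c).app M) n := by
    rw [hτ, CentricLinkingSystem.Chain.cohMap_eq_homologyMap]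
    refine (congrArg (fun t => L.restrict (w.R c) M n ≫ t)
      (HomologicalComplex.homologyMap_comp _ _ _).symm).trans ?_
    exact (HomologicalComplex.homologyMap_comp _ _ _).symm
  refine ⟨∑ c, θ c, fun M n => ?_⟩
  rw [app, finsum_eq_sum_of_fintype, NatTrans.app_sum]
  refine (Finset.sum_congr rfl fun c _ => hθ c M n).trans ?_
  exact ((HomologicalComplex.homologyFunctor _ _ n).map_sum _ _).symm

variable (w : OmegaEndomorphism L Ω) (p : ℕ) [Fact p.Prime]

/-- Homology of the naturality square of $\theta$ at $f$; the scalar passes through linear maps. -/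
lemma map_comp_normalized {M N : Rep.{0} (ZLoc p) L.fundGroup} (f : M ⟶ N) (n : ℕ) :
    (groupCohomology.functor (ZLoc p) S n).map ((Rep.resFunctor L.toFundGroup).map f) ≫
        w.normalized p N n =
      w.normalized p M n ≫
        (groupCohomology.functor (ZLoc p) S n).map ((Rep.resFunctor L.toFundGroup).map f) := by
  obtain ⟨θ, hθ⟩ := w.exists_natTrans_app (ZLoc p)
  have h := congrArg (fun t => HomologicalComplex.homologyMap t n) (θ.naturality f)
  refine End.comp_smul_eq_smul_comp ?_ _
  rw [hθ, hθ]
  exact (HomologicalComplex.homologyMap_comp _ _ _).symm.trans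
    (h.trans (HomologicalComplex.homologyMap_comp _ _ _))

/-- Exactness of cochains turns `X` into a short exact sequence of complexes, on which $\theta$
acts; connecting maps are natural for such an action. -/
lemma δ_comp_normalized {X : ShortComplex (Rep.{0} (ZLoc p) L.fundGroup)} (hX : X.ShortExact)
    (n : ℕ) :
    groupCohomology.δ ((Rep.shortExact_res L.toFundGroup).2 hX) n (n + 1) rfl ≫
        w.normalized p X.X₁ (n + 1) =
      w.normalized p X.X₃ n ≫
        groupCohomology.δ ((Rep.shortExact_res L.toFundGroup).2 hX) n (n + 1) rfl := by
  obtain ⟨θ, hθ⟩ := w.exists_natTrans_app (ZLoc p)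
  have hS := map_cochainsFunctor_shortExact ((Rep.shortExact_res L.toFundGroup).2 hX)
  have h := HomologicalComplex.HomologySequence.δ_naturality (X.mapNatTrans θ) hS hS n (n + 1) rfl
  refine End.comp_smul_eq_smul_comp ?_ _
  rw [hθ, hθ]
  exact h

end OmegaEndomorphism

end Main

/-! ### The characteristic idempotents -/

theorem proposition4p10 (p : ℕ) [Fact p.Prime] {S : Type} [Group S] [Finite S]
    (hS : IsPGroup p S) (F : FusionSystem S) (hF : F.IsSaturated p)
    (L : CentricLinkingSystem F)
    {Ω : Type} [Finite Ω] [MulAction S Ω] [MulAction Sᵐᵒᵖ Ω] [SMulCommClass S Sᵐᵒᵖ Ω]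
    (hΩ : F.IsCharacteristic Ω p) (w : OmegaEndomorphism L Ω) :
    (∃ N : ℕ → Rep.{0} (ZLoc p) L.fundGroup → ℕ, w.IsIdempotentExponent p N) ∧
    ∀ N : ℕ → Rep.{0} (ZLoc p) L.fundGroup → ℕ, w.IsIdempotentExponent p N →
      (∀ (M : Rep.{0} (ZLoc p) L.fundGroup) (n : ℕ), Finite M →
        IsIdempotentElem (w.charIdempotent p N M n)) ∧
      L.IsDeltaEndomorphism (w.charIdempotent p N) := by
  refine ⟨?_, fun N hN => ?_⟩
  · have key (n : ℕ) (M : Rep.{0} (ZLoc p) L.fundGroup) : ∃ m : ℕ, Finite M →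
        0 < m ∧ IsIdempotentElem (w.normalized p M n ^ m) := by
      by_cases hM : Finite M
      · have : Finite (L.cohS M n) :=
          have : Finite (L.resS M) := hM
          groupCohomology.finite _ n
        have := ModuleCat.finite_end (L.cohS M n)
        obtain ⟨m, hm⟩ := exists_pos_isIdempotentElem_pow (w.normalized p M n)
        exact ⟨m, fun _ => hm⟩
      · exact ⟨0, fun h => absurd h hM⟩
    choose N hN using key
    exact ⟨N, hN⟩
  · have pos (M : Rep.{0} (ZLoc p) L.fundGroup) (hM : Finite M) (n : ℕ) :
        0 < ∏ i ∈ Finset.range (n + 1), N i M := Finset.prod_pos fun i _ => (hN i M hM).1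
    have idem (M : Rep.{0} (ZLoc p) L.fundGroup) (n : ℕ) (hM : Finite M) :
        IsIdempotentElem (w.charIdempotent p N M n) := by
      -- The product contains the factor $N_{n,M}$, so this power equals the $N_{n,M}$-th one.
      rw [OmegaEndomorphism.charIdempotent, (hN n M hM).2.pow_eq_of_dvd (pos M hM n)
        (Finset.dvd_prod_of_mem _ (Finset.self_mem_range_succ n))]
      exact (hN n M hM).2
    exact ⟨idem,
      { natural := fun n M N' hM hN' f => End.comp_pow_eq_pow_comp_of_isIdempotentElem
          (w.map_comp_normalized p f n) (pos M hM n) (pos N' hN' n) (idem M n hM) (idem N' n hN')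
        comm_δ := fun X hX h₁ _ h₃ n => End.comp_pow_eq_pow_comp_of_isIdempotentElem
          (w.δ_comp_normalized p hX n) (pos _ h₃ n) (pos _ h₁ (n + 1)) (idem _ n h₃)
          (idem _ (n + 1) h₁) }⟩
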